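/- **Theorem 1 (Achievability for Error Metric 1).** For $x\in\mathbb C^M$ let $\mathrm{supp}(x)=\{i: x_i\ne 0\}$ and $\mu(x)=\min_{i\in\mathrm{supp}(x)}|x_i|$. A vector $x\in\mathbb C^M$ is observed through $y=Ax+n$, where $A$ is an $N\times M$ matrix with i.i.d. circularly-symmetric complex Gaussian entries of law $\mathcal N_{\mathbb C}(0,1)$ and $n\sim\mathcal N_{\mathbb C}(0,\nu^2 I_N)$ is independent of $A$, with $\nu>0$. For $L\in\mathbb N$ and $\delta\in\mathbb R$, call $y$ and a set $J\subset\{1,\dots,M\}$ with $|J|=L$ *$\delta$-jointly typical* if the matrix $A_J$ of the columns of $A$ with index in $J$ has rank $L$ and $$\Big|\tfrac1N\|\Pi^{\perp}_{A_J}y\|_2^2-\tfrac{N-L}{N}\nu^2\Big|<\delta ,$$ where $\Pi^\perp_{A_J}$ is the orthogonal projection onto the orthogonal complement of the column span of $A_J$. The $\delta$-joint-typicality decoder $\mathcal D$ outputs the set $J$ with $|J|=L$ that is $\delta$-jointly typical with $y$ if there is exactly one such set, and otherwise declares a failure. Its average error probability (exact support recovery, Error Metric 1) is $p_{\rm err}(\mathcal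 D\mid x)=\mathbb E_A\big[\mathbb P_n(\mathcal D(y)\ne \mathrm{supp}(x))\big]$. For functions $f,g$ of $M$ write $f\succ g$ if either $f=g=0$ identically, or $f$ and $g$ are non-negative and non-decreasing and there is $M_0$ such that $f(M)/g(M)>1$ for all $M>M_0$. Let $\beta>2$ and $L=L(M)=\lfloor M/\beta\rfloor$. There is a constant $C_1>1$ depending only on $\beta$ such that the following holds for every $\nu>0$ and every $\zeta\in(0,1)$. Let $x^{(M)}\in\mathbb C^M$, $M\in\mathbb N$, be a sequence of vectors with $|\mathrm{supp}(x^{(M)})|=L(M)$ for all $M$ and $$\frac{L\,\mu(x^{(M)})^4}{\log L}\to\infty\qquad(M\to\infty),$$ and let the numbers of measurements $N=N(M)$ satisfy $N\succ C_1L$. Then the joint-typicality decoders $\mathcal D=\mathcal D_M$ with threshold $\delta=\zeta\,\mu(x^{(M)})^2\,\frac{N-L}{N}$ achieve asymptotic reliable recovery, $$p_{\rm err}(\mathcal D\mid x^{(M)})\to0 \qquad (M\to\infty),$$ and moreover the error decays faster than every power of $1/L$: $$\frac{-\log p_{\rm err}(\mathcal D\mid x^{(M)})}{\log L}\to\infty\qquad(M\to\infty),$$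 where $-\log 0=\infty$. -/

import Mathlib

open MeasureTheory ProbabilityTheory Filter Topology
open scoped ENNReal NNReal

noncomputable section

namespace SparseRecovery

/-- The circularly-symmetric complex Gaussian law `N_C(0, v)`: real and imaginary parts are
independent real Gaussians with mean `0` and variance `v / 2`, so that `E |z|² = v`. -/
def complexGaussian (v : ℝ≥0) : Measure ℂ :=
  ((gaussianReal 0 (v / 2)).prod (gaussianReal 0 (v / 2))).map
    (fun p : ℝ × ℝ => Complex.mk p.1 p.2)

/-- The law of the array of entries of an `N × M` Gaussian measurement matrix: the entries are
i.i.d. with law `N_C(0, 1)`. -/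
def matrixLaw (N M : ℕ) : Measure (Fin N → Fin M → ℂ) :=
  Measure.pi fun _ : Fin N => Measure.pi fun _ : Fin M => complexGaussian 1

/-- The law `N_C(0, ν² I_N)` of the noise vector. -/
def noiseLaw (ν : ℝ) (N : ℕ) : Measure (Fin N → ℂ) :=
  Measure.pi fun _ : Fin N => complexGaussian (Real.toNNReal (ν ^ 2))

/-- The sparsity `L = ⌊M / β⌋`. -/
def sparsity (β : ℝ) (M : ℕ) : ℕ := ⌊(M : ℝ) / β⌋₊

/-- The support of a vector. -/
def supp {M : ℕ} (x : Fin M → ℂ) : Finset (Fin M) :=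
  open Classical in Finset.univ.filter fun i => x i ≠ 0

/-- `μ(x)`, the smallest modulus of a non-zero coordinate of `x` (an infimum over a finite set,
hence a minimum; `0` by convention if `x = 0`). -/
def minAbs {M : ℕ} (x : Fin M → ℂ) : ℝ := ⨅ i : supp x, ‖x i‖

/-- The noisy observation `y = A x + n`. -/
def observation {N M : ℕ} (A : Matrix (Fin N) (Fin M) ℂ) (x : Fin M → ℂ) (n : Fin N → ℂ) :
    Fin N → ℂ :=
  A.mulVec x + n

/-- `A_J`, the matrix whose columns are the columns of `A` with index in `J`. -/
def columns {N M : ℕ} (A : Matrix (Fin N) (Fin M) ℂ) (J : Finset (Fin M)) :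
    Matrix (Fin N) J ℂ :=
  A.submatrix id Subtype.val

/-- The span of the columns of `A_J`, as a subspace of the Euclidean space `ℂ^N`. -/
def columnSpan {N M : ℕ} (A : Matrix (Fin N) (Fin M) ℂ) (J : Finset (Fin M)) :
    Submodule ℂ (EuclideanSpace ℂ (Fin N)) :=
  Submodule.span ℂ (Set.range fun j : J => WithLp.toLp 2 ((columns A J).col j))

/-- `‖Π^⊥ y‖²`, where `Π^⊥` is the orthogonal projection onto the orthogonal complement of the
span of the columns of `A_J`. -/
def residual {N M : ℕ} (A : Matrix (Fin N) (Fin M) ℂ) (J : Finset (Fin M)) (y : Fin N → ℂ) : ℝ :=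
  ‖(columnSpan A J)ᗮ.starProjection (WithLp.toLp 2 y)‖ ^ 2

/-- `y` and the index set `J` with `|J| = L` are `δ`-jointly typical. -/
def JointlyTypical {N M : ℕ} (ν δ : ℝ) (L : ℕ) (A : Matrix (Fin N) (Fin M) ℂ) (y : Fin N → ℂ)
    (J : Finset (Fin M)) : Prop :=
  J.card = L ∧ (columns A J).rank = L ∧
    |1 / (N : ℝ) * residual A J y - ((N : ℝ) - L) / N * ν ^ 2| < δ

/-- A decoder: from the measurement matrix and the observation it produces a set of indices, or
declares a failure (`none`). -/
abbrev Decoder (N M : ℕ) : Type :=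
  Matrix (Fin N) (Fin M) ℂ → (Fin N → ℂ) → Option (Finset (Fin M))

/-- The joint-typicality decoder: it outputs the index set `J` with `|J| = L` that is `δ`-jointly
typical with `y` if there is exactly one such set, and declares a failure otherwise. -/
def typicalityDecoder (N M : ℕ) (ν δ : ℝ) (L : ℕ) : Decoder N M := fun A y =>
  open Classical in
  if h : ∃! J : Finset (Fin M), JointlyTypical ν δ L A y J then some h.choose else none

/-- `p_err(A | x) = P(D(y) ≠ supp x)`, the probability over the noise that the support is not
recovered exactly, for a given measurement matrix `A`. -/
def errorProbGiven {N M : ℕ} (D : Decoder N M) (ν : ℝ) (x : Fin M → ℂ)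
    (A : Matrix (Fin N) (Fin M) ℂ) : ℝ≥0∞ :=
  noiseLaw ν N {n | D A (observation A x n) ≠ some (supp x)}

/-- `p_err(D | x) = E_A (p_err(A | x))`, the error probability averaged over Gaussian `A`. -/
def errorProb {N M : ℕ} (D : Decoder N M) (ν : ℝ) (x : Fin M → ℂ) : ℝ≥0∞ :=
  ∫⁻ A, errorProbGiven D ν x (Matrix.of A) ∂(matrixLaw N M)

/-- The relation `f ≻ g`. -/
def Dominates (f g : ℕ → ℝ) : Prop :=
  (∀ M, f M = 0 ∧ g M = 0) ∨
    (Monotone f ∧ Monotone g ∧ (∀ M, 0 ≤ f M) ∧ (∀ M, 0 ≤ g M) ∧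
      ∃ M₀ : ℕ, ∀ M > M₀, 1 < f M / g M)

/-- A sequence of decoders achieves asymptotic reliable sparse recovery (Error Metric 1). -/
def AsymptoticallyReliable {N : ℕ → ℕ} (D : ∀ M, Decoder (N M) M) (ν : ℝ)
    (x : ∀ M, Fin M → ℂ) : Prop :=
  Tendsto (fun M => errorProb (D M) ν (x M)) atTop (𝓝 0)

/-- The threshold `δ = ζ μ² (N - L) / N` for joint typicality, where `μ` is the smallest modulus
of a non-zero coordinate of the signal. -/
def threshold (ζ μ : ℝ) (N L : ℕ) : ℝ := ζ * μ ^ 2 * (((N : ℝ) - L) / N)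

end SparseRecovery

end

noncomputable section

namespace SparseRecovery

/-! Write `d = N - L` and `I = supp x`. Projecting `y` off the columns in `J` removes their part of
the signal. What remains is a Gaussian vector independent of `A_J`, with variance `σ_J = ν² + ∑_{i ∉
J} |x_i|²` per coordinate. By unitary invariance the squared norm of its projection has Laplace
transform `(1 + sσ_J)⁻¹` to the power of the codimension of the column span. Chernoff bounds
therefore have rate `r - 1 - log r` per dimension (`lintegral_noiseLaw_residual_le`,
`noiseLaw_residual_of_rank`).

Failure requires either that the residual of `I` leaves its window around `dν²`, or that some wrong
`J` has residual below `d(ν² + ζμ²)`. If `J` misses `k` elements of `I`, then `σ_J ≥ ν² + kμ²`, so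
the second event is a lower-tail deviation with ratio at most `levelRatio`. There are at most `min
(M^(2k)) (2^M)` such `J` (`errorProb_le`).

With `d ≥ L`, the rate beats the count for every `k` (`union_term_le`). For `k ≤ L^(3/4)` the count
is `exp(O(k log L))`, while `L` times the rate is at least of order `k L μ⁴` or `L`, according to
whether `kμ² ≤ ν²`. For larger `k` the rate itself grows like `(log L)/4` and beats `2^M =
exp(O(L))`. Each term is thus below any fixed power of `1/L`, and there are only `L` values of `k`.
-/

/-! ### Complex Gaussian vectors and their Laplace transforms. -/

lemma measurable_complex_mk : Measurable fun p : ℝ × ℝ => Complex.mk p.1 p.2 :=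
  Complex.measurableEquivRealProd.symm.measurable

instance (v : ℝ≥0) : IsProbabilityMeasure (complexGaussian v) :=
  Measure.isProbabilityMeasure_map measurable_complex_mk.aemeasurable

instance (N M : ℕ) : IsProbabilityMeasure (matrixLaw N M) := by
  unfold matrixLaw; infer_instance

instance (ν : ℝ) (N : ℕ) : IsProbabilityMeasure (noiseLaw ν N) := by
  unfold noiseLaw; infer_instance

lemma charFun_complexGaussian (v : ℝ≥0) (t : ℂ) :
    charFun (complexGaussian v) t = Complex.exp (-(v * ‖t‖ ^ 2 / 4 : ℝ)) := by
  have h (w : ℝ≥0) (u : ℝ) : ∫ x, Complex.exp (x * u * Complex.I) ∂gaussianReal 0 w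
      = Complex.exp (-(w * u ^ 2 / 2 : ℝ)) := by
    have := charFun_gaussianReal (μ := 0) (v := w) u
    rw [charFun_apply_real] at this
    convert! this using 2
    · ext x; ring_nf
    · push_cast; ring
  rw [charFun_apply, complexGaussian, integral_map measurable_complex_mk.aemeasurable
    (by fun_prop)]
  have : ∀ p : ℝ × ℝ, Complex.exp ((inner ℝ (Complex.mk p.1 p.2) t : ℝ) * Complex.I)
      = Complex.exp (p.1 * t.re * Complex.I) * Complex.exp (p.2 * t.im * Complex.I) := by
    intro p
    rw [← Complex.exp_add, Complex.inner]
    congr 1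
    simp
    ring
  simp_rw [this]
  rw [integral_prod_mul (fun x : ℝ => Complex.exp (x * t.re * Complex.I))
    (fun x : ℝ => Complex.exp (x * t.im * Complex.I)), h, h, ← Complex.exp_add,
    ← Complex.normSq_eq_norm_sq, Complex.normSq_apply]
  congr 1
  push_cast
  ring

lemma lintegral_exp_neg_mul_sq_gaussianReal (v : ℝ≥0) (s : ℝ) (h : 0 < 1 + 2 * s * v) :
    ∫⁻ x, ENNReal.ofReal (Real.exp (-s * x ^ 2)) ∂gaussianReal 0 v
      = ENNReal.ofReal (√(1 + 2 * s * v))⁻¹ := by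
  rcases eq_or_ne v 0 with rfl | hv
  · simp
  have hv' : (0 : ℝ) < v := by positivity
  rw [gaussianReal_of_var_ne_zero _ hv, lintegral_withDensity_eq_lintegral_mul _
    (measurable_gaussianPDF _ _) (by fun_prop)]
  have hb : 0 < (1 + 2 * s * v) / (2 * v) := by positivity
  have e : ∀ x : ℝ, (gaussianPDF 0 v * fun x => ENNReal.ofReal (Real.exp (-s * x ^ 2))) x
      = ENNReal.ofReal ((√(2 * Real.pi * v))⁻¹ *
        Real.exp (-((1 + 2 * s * v) / (2 * v)) * x ^ 2)) := by
    intro x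
    rw [Pi.mul_apply, gaussianPDF, ← ENNReal.ofReal_mul (gaussianPDFReal_nonneg _ _ _),
      gaussianPDFReal, mul_assoc, ← Real.exp_add]
    congr 3
    field_simp
    ring
  simp_rw [e]
  rw [← ofReal_integral_eq_lintegral_ofReal ((integrable_exp_neg_mul_sq hb).const_mul _)
    (ae_of_all _ fun x => by positivity), integral_const_mul, integral_gaussian,
    ← Real.sqrt_inv, ← Real.sqrt_mul (by positivity), ← Real.sqrt_inv]
  congr 2
  field_simp

lemma lintegral_exp_neg_mul_norm_sq_complexGaussian (v : ℝ≥0) (s : ℝ) (h : 0 < 1 + s * v) :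
    ∫⁻ z, ENNReal.ofReal (Real.exp (-s * ‖z‖ ^ 2)) ∂complexGaussian v
      = ENNReal.ofReal (1 + s * v)⁻¹ := by
  rw [complexGaussian, lintegral_map (by fun_prop) measurable_complex_mk]
  have e : ∀ p : ℝ × ℝ, ENNReal.ofReal (Real.exp (-s * ‖Complex.mk p.1 p.2‖ ^ 2))
      = ENNReal.ofReal (Real.exp (-s * p.1 ^ 2)) * ENNReal.ofReal (Real.exp (-s * p.2 ^ 2)) := by
    intro p
    rw [← ENNReal.ofReal_mul (by positivity), ← Real.exp_add, ← Complex.normSq_eq_norm_sq,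
      Complex.normSq_apply]
    congr 2
    ring
  have hv : 1 + 2 * s * ((v / 2 : ℝ≥0) : ℝ) = 1 + s * v := by push_cast; ring
  simp_rw [e]
  rw [lintegral_prod_mul (f := fun x => ENNReal.ofReal (Real.exp (-s * x ^ 2)))
    (g := fun x => ENNReal.ofReal (Real.exp (-s * x ^ 2))) (by fun_prop) (by fun_prop),
    lintegral_exp_neg_mul_sq_gaussianReal _ _ (by rw [hv]; exact h), hv,
    ← ENNReal.ofReal_mul (by positivity), ← mul_inv, Real.mul_self_sqrt h.le]

/-- The law of a weighted sum of independent standard complex Gaussians plus Gaussian noise. -/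
lemma measurePreserving_sum_mul_add {ι : Type*} [Fintype ι] (x : ι → ℂ) (v : ℝ≥0) :
    MeasurePreserving (fun p : (ι → ℂ) × ℂ => ∑ i, p.1 i * x i + p.2)
      ((Measure.pi fun _ => complexGaussian 1).prod (complexGaussian v))
      (complexGaussian (v + ∑ i, ‖x i‖₊ ^ 2)) := by
  refine ⟨by fun_prop, ?_⟩
  have hm : Measurable fun u : ι → ℂ => ∑ i, u i * x i := by fun_prop
  have hind := indepFun_prod (X := fun u : ι → ℂ => ∑ i, u i * x i) (Y := (id : ℂ → ℂ))
    (μ := Measure.pi fun _ => complexGaussian 1) (ν := complexGaussian v) hm measurable_id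
  refine Measure.ext_of_charFun ?_
  have h1 := hind.charFun_map_fun_add_eq_mul (by fun_prop) (by fun_prop)
  have h2 : Measure.map (fun p : (ι → ℂ) × ℂ => ∑ i, p.1 i * x i)
      ((Measure.pi fun _ => complexGaussian 1).prod (complexGaussian v)) =
      (Measure.pi fun _ => complexGaussian 1).map fun u : ι → ℂ => ∑ i, u i * x i := by
    rw [← (measurePreserving_fst (μ := Measure.pi fun _ : ι => complexGaussian 1)
      (ν := complexGaussian v)).map_eq, Measure.map_map hm measurable_fst]
    rw [(measurePreserving_fst (μ := Measure.pi fun _ : ι => complexGaussian 1)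
      (ν := complexGaussian v)).map_eq]
    rfl
  have h3 : Measure.map (fun p : (ι → ℂ) × ℂ => id p.2)
      ((Measure.pi fun _ => complexGaussian 1).prod (complexGaussian v)) = complexGaussian v :=
    measurePreserving_snd.map_eq
  have h4 := iIndepFun.charFun_map_fun_sum_eq_prod (P := Measure.pi fun _ : ι => complexGaussian 1)
    (X := fun i (u : ι → ℂ) => u i * x i) (fun i => Measurable.aemeasurable (by fun_prop))
    (iIndepFun_pi (X := fun i (z : ℂ) => z * x i) (fun i => Measurable.aemeasurable (by fun_prop)))
  simp only [id] at h1 h3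
  rw [h1, h2, h3, h4]
  have h5 (i : ι) (t : ℂ) : charFun ((Measure.pi fun _ : ι => complexGaussian 1).map
      fun u : ι → ℂ => u i * x i) t = Complex.exp (-(‖x i‖ ^ 2 * ‖t‖ ^ 2 / 4 : ℝ)) := by
    have : (Measure.pi fun _ : ι => complexGaussian 1).map (fun u : ι → ℂ => u i * x i)
        = (complexGaussian 1).map fun z => z * x i := by
      conv_rhs => rw [← (measurePreserving_eval (fun _ : ι => complexGaussian 1) i).map_eq,
        Measure.map_map (by fun_prop) (by fun_prop)]
      rfl
    rw [this, charFun_apply, integral_map (by fun_prop) (by fun_prop)]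
    -- The adjoint of multiplication by `x i` is multiplication by its conjugate, which moves the
    -- scaling onto `t`.
    have e : ∀ z : ℂ, inner ℝ (z * x i) t = inner ℝ z (starRingEnd ℂ (x i) * t) := by
      intro z
      simp only [Complex.inner, map_mul]
      ring_nf
    simp_rw [e]
    rw [← charFun_apply, charFun_complexGaussian]
    simp [mul_pow]
  ext t
  simp only [Pi.mul_apply, Finset.prod_apply, h5, charFun_complexGaussian]
  rw [← Complex.exp_sum, ← Complex.exp_add]
  congr 1
  push_cast
  simp only [Finset.sum_neg_distrib, ← Finset.sum_div, ← Finset.sum_mul]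
  ring

/-- A complex Gaussian vector with i.i.d. centered coordinates has i.i.d. coordinates with the same
law in every orthonormal basis. -/
lemma measurePreserving_repr {ι : Type*} [Fintype ι] (v : ℝ≥0)
    (b : OrthonormalBasis ι ℂ (EuclideanSpace ℂ ι)) :
    MeasurePreserving (fun (z : ι → ℂ) i => b.repr (WithLp.toLp 2 z) i)
      (Measure.pi fun _ => complexGaussian v) (Measure.pi fun _ => complexGaussian v) := by
  have hc : Continuous fun (z : ι → ℂ) i => b.repr (WithLp.toLp 2 z) i := by fun_prop
  refine ⟨hc.measurable, ?_⟩
  rw [← charFun_eq_pi_iff]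
  intro t
  -- The product characteristic function depends only on `‖u‖`, so it is unchanged by the unitary
  -- map `b.repr.symm`.
  have key (u : PiLp 2 fun _ : ι => ℂ) : ∏ i, charFun (complexGaussian v) (u i)
      = Complex.exp (-(v * ‖u‖ ^ 2 / 4 : ℝ)) := by
    simp_rw [charFun_complexGaussian]
    rw [← Complex.exp_sum, PiLp.norm_sq_eq_of_L2]
    congr 1
    push_cast
    rw [Finset.sum_neg_distrib, Finset.mul_sum, Finset.sum_div]
  have e (x y : EuclideanSpace ℂ ι) : inner ℝ x y = (inner ℂ x y).re := by
    simp only [PiLp.inner_apply, Complex.re_sum]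
    rfl
  rw [Measure.map_map (by fun_prop) hc.measurable, key, charFun_apply,
    integral_map (by fun_prop) (by fun_prop)]
  have e2 : ∀ z : ι → ℂ, inner ℝ ((WithLp.toLp 2 ∘ fun (z : ι → ℂ) i =>
      b.repr (WithLp.toLp 2 z) i) z) t = inner ℝ (WithLp.toLp 2 z) (b.repr.symm t) := by
    intro z
    rw [e, e]
    have : (WithLp.toLp 2 ∘ fun (z : ι → ℂ) i => b.repr (WithLp.toLp 2 z) i) z
      = b.repr (WithLp.toLp 2 z) := rfl
    rw [this, LinearIsometryEquiv.inner_map_eq_flip]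
  simp_rw [e2]
  rw [← LinearIsometryEquiv.norm_map b.repr.symm t, ← key, ← charFun_pi, charFun_apply,
    integral_map (by fun_prop) (by fun_prop)]

/-- The Laplace transform of the squared norm of the projection of a Gaussian vector. -/
lemma lintegral_exp_neg_mul_norm_starProjection_sq {N : ℕ} (v : ℝ≥0) (s : ℝ) (h : 0 < 1 + s * v)
    (K : Submodule ℂ (EuclideanSpace ℂ (Fin N))) :
    ∫⁻ z, ENNReal.ofReal (Real.exp (-s * ‖K.starProjection (WithLp.toLp 2 z)‖ ^ 2))
      ∂(Measure.pi fun _ => complexGaussian v)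
      = ENNReal.ofReal ((1 + s * v)⁻¹ ^ Module.finrank ℂ K) := by
  set d := Module.finrank ℂ K with hd
  have hdN : d ≤ N := by simpa using Submodule.finrank_le K
  let u : OrthonormalBasis (Fin d) ℂ K := stdOrthonormalBasis ℂ K
  let w : Fin N → EuclideanSpace ℂ (Fin N) := fun i => if hi : i.1 < d then u ⟨i, hi⟩ else 0
  let S : Set (Fin N) := {i | i.1 < d}
  have hon : Orthonormal ℂ (S.domRestrict w) := by
    have h1 : Orthonormal ℂ fun i : Fin d => (u i : EuclideanSpace ℂ (Fin N)) :=
      u.orthonormal.comp_linearIsometry K.subtypeₗᵢ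
    have h2 := h1.comp (fun i : S => (⟨i.1.1, i.2⟩ : Fin d)) (by
      intro i j hij
      simpa [Subtype.ext_iff, Fin.ext_iff] using hij)
    convert! h2 using 1
    ext1 i
    have : i.1.1 < d := i.2
    simp [w, Set.domRestrict, this]
  obtain ⟨b, hb⟩ := hon.exists_orthonormalBasis_extension_of_card_eq (by simp)
  have hnorm (z : Fin N → ℂ) : ‖K.starProjection (WithLp.toLp 2 z)‖ ^ 2
      = ∑ i : Fin N, if i.1 < d then ‖b.repr (WithLp.toLp 2 z) i‖ ^ 2 else 0 := by
    have h1 : ‖K.starProjection (WithLp.toLp 2 z)‖ ^ 2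
        = ∑ i : Fin d, ‖inner ℂ (u i : EuclideanSpace ℂ (Fin N)) (WithLp.toLp 2 z)‖ ^ 2 := by
      change ‖K.orthogonalProjectionOnto (WithLp.toLp 2 z)‖ ^ 2 = _
      rw [← u.sum_sq_norm_inner_right]
      refine Finset.sum_congr rfl fun i _ => ?_
      rw [Submodule.inner_orthogonalProjectionOnto_eq_of_mem_left]
    rw [h1, ← Finset.sum_filter]
    refine Finset.sum_bij (fun i _ => (⟨i, i.2.trans_le hdN⟩ : Fin N)) (by simp)
      (by simp [Fin.ext_iff]) (fun i hi => ⟨⟨i, by simpa using hi⟩, by simp, rfl⟩) ?_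
    intro i _
    rw [b.repr_apply_apply, hb _ (show (⟨i, i.2.trans_le hdN⟩ : Fin N) ∈ S from i.2)]
    simp [w]
  obtain ⟨f, hf⟩ : ∃ f : Fin N → ℂ → ℝ≥0∞, f = fun i a =>
    if i.1 < d then ENNReal.ofReal (Real.exp (-s * ‖a‖ ^ 2)) else 1 := ⟨_, rfl⟩
  have hprod : ∀ z : Fin N → ℂ, ENNReal.ofReal
      (Real.exp (-s * ‖K.starProjection (WithLp.toLp 2 z)‖ ^ 2))
      = ∏ i : Fin N, f i (b.repr (WithLp.toLp 2 z) i) := by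
    intro z
    simp only [hnorm, Finset.mul_sum, Real.exp_sum]
    rw [ENNReal.ofReal_prod_of_nonneg (fun _ _ => by positivity)]
    refine Finset.prod_congr rfl fun i _ => ?_
    simp only [hf]
    split_ifs <;> simp
  have hmi (i : Fin N) : Measurable (f i) := by
    simp only [hf]
    split_ifs <;> fun_prop
  have h6 (i : Fin N) : ∫⁻ c : Fin N → ℂ, f i (c i) ∂(Measure.pi fun _ => complexGaussian v)
      = if i.1 < d then ENNReal.ofReal (1 + s * v)⁻¹ else 1 := by
    rw [(measurePreserving_eval (fun _ : Fin N => complexGaussian v) i).lintegral_comp (hmi i), hf]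
    by_cases hi : i.1 < d
    · simpa only [hi, if_true] using lintegral_exp_neg_mul_norm_sq_complexGaussian v s h
    · simp [hi]
  simp_rw [hprod]
  rw [(measurePreserving_repr v b).lintegral_comp (f := fun c => ∏ i, f i (c i))
    (Finset.measurable_fun_prod _ fun i _ => (hmi i).comp (measurable_pi_apply i)),
    lintegral_prod_eq_prod_lintegral_of_indepFun Finset.univ (fun i (c : Fin N → ℂ) => f i (c i))
    (iIndepFun_pi fun i => (hmi i).aemeasurable) fun i => (hmi i).comp (measurable_pi_apply i)]
  simp_rw [h6]
  rw [Finset.prod_ite, Finset.prod_const_one, mul_one, Finset.prod_const,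
    ENNReal.ofReal_pow (by positivity)]
  congr 1
  rw [Fin.card_filter_val_lt]
  omega


/-! ### Distance to a column span. -/

/-- The span of the columns of a matrix, as a subspace of Euclidean space. -/
def colSpan {N : ℕ} {κ : Type*} (B : Matrix (Fin N) κ ℂ) :
    Submodule ℂ (EuclideanSpace ℂ (Fin N)) :=
  Submodule.span ℂ (Set.range fun j => WithLp.toLp 2 (B.col j))

/-- The squared distance of a vector to the span of the columns of a matrix. -/
def distSqColSpan {N : ℕ} {κ : Type*} (B : Matrix (Fin N) κ ℂ) (w : Fin N → ℂ) : ℝ :=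
  ‖(colSpan B)ᗮ.starProjection (WithLp.toLp 2 w)‖ ^ 2

lemma residual_eq {N M : ℕ} (A : Matrix (Fin N) (Fin M) ℂ) (J : Finset (Fin M)) (y : Fin N → ℂ) :
    residual A J y = distSqColSpan (columns A J) y := rfl

lemma finrank_colSpan_orthogonal {N : ℕ} {κ : Type*} (B : Matrix (Fin N) κ ℂ) :
    Module.finrank ℂ (colSpan B)ᗮ = N - Module.finrank ℂ (colSpan B) := by
  have := Submodule.finrank_add_finrank_orthogonal (colSpan B)
  rw [finrank_euclideanSpace_fin] at this
  omega

section colSpan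
variable {N : ℕ} {κ : Type*} [Fintype κ]

lemma mem_colSpan_iff (B : Matrix (Fin N) κ ℂ) (w : EuclideanSpace ℂ (Fin N)) :
    w ∈ colSpan B ↔ ∃ c : κ → ℂ, WithLp.toLp 2 (B.mulVec c) = w := by
  rw [colSpan, Submodule.mem_span_range_iff_exists_fun]
  refine exists_congr fun c => ?_
  have : ∑ i, c i • WithLp.toLp 2 (B.col i) = WithLp.toLp 2 (B.mulVec c) := by
    ext r
    simp [Matrix.mulVec, dotProduct, Matrix.col, mul_comm]
  rw [this]

lemma distSqColSpan_eq_iInf (B : Matrix (Fin N) κ ℂ) (w : Fin N → ℂ) :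
    distSqColSpan B w = (⨅ c : κ → ℂ, ‖WithLp.toLp 2 (w - B.mulVec c)‖) ^ 2 := by
  rw [distSqColSpan, Submodule.starProjection_orthogonal_val, Submodule.starProjection_minimal]
  congr 1
  have hs : Function.Surjective fun c : κ → ℂ =>
      (⟨WithLp.toLp 2 (B.mulVec c), (mem_colSpan_iff B _).2 ⟨c, rfl⟩⟩ : colSpan B) := by
    rintro ⟨w, hw⟩
    obtain ⟨c, hc⟩ := (mem_colSpan_iff B w).1 hw
    exact ⟨c, Subtype.ext hc⟩
  rw [← hs.iInf_comp]
  rfl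

/-- The projection is discontinuous where the rank drops. The distance is still an infimum of
continuous functions, hence upper semicontinuous. -/
lemma measurable_distSqColSpan : Measurable fun p : (Fin N → κ → ℂ) × (Fin N → ℂ) =>
    distSqColSpan (Matrix.of p.1) p.2 := by
  simp_rw [distSqColSpan_eq_iInf]
  refine Measurable.pow_const (UpperSemicontinuous.measurable ?_) 2
  refine upperSemicontinuous_ciInf (fun p => ⟨0, ?_⟩) fun c => Continuous.upperSemicontinuous ?_
  · rintro _ ⟨c, rfl⟩
    positivity
  · have : Continuous fun p : (Fin N → κ → ℂ) × (Fin N → ℂ) => p.2 - (Matrix.of p.1).mulVec c :=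
      continuous_snd.sub (Continuous.matrix_mulVec (A := fun p : (Fin N → κ → ℂ) × (Fin N → ℂ) =>
        Matrix.of p.1) continuous_fst continuous_const)
    fun_prop

lemma distSqColSpan_mulVec_add (B : Matrix (Fin N) κ ℂ) (c : κ → ℂ) (w : Fin N → ℂ) :
    distSqColSpan B (B.mulVec c + w) = distSqColSpan B w := by
  rw [distSqColSpan, WithLp.toLp_add, map_add, distSqColSpan]
  have : (colSpan B)ᗮ.starProjection (WithLp.toLp 2 (B.mulVec c)) = 0 := by
    rw [Submodule.starProjection_apply_eq_zero_iff, Submodule.orthogonal_orthogonal]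
    exact (mem_colSpan_iff B _).2 ⟨c, rfl⟩
  rw [this, zero_add]

lemma finrank_colSpan_le (B : Matrix (Fin N) κ ℂ) :
    Module.finrank ℂ (colSpan B) ≤ Fintype.card κ :=
  finrank_range_le_card _

lemma finrank_colSpan (B : Matrix (Fin N) κ ℂ) : Module.finrank ℂ (colSpan B) = B.rank := by
  rw [Matrix.rank_eq_finrank_span_cols, colSpan,
    ← LinearEquiv.finrank_map_eq (WithLp.linearEquiv 2 ℂ (Fin N → ℂ)), Submodule.map_span,
    ← Set.range_comp]
  rfl

lemma lintegral_exp_neg_mul_distSqColSpan (v : ℝ≥0) (s : ℝ) (h : 0 < 1 + s * v)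
    (B : Matrix (Fin N) κ ℂ) :
    ∫⁻ z, ENNReal.ofReal (Real.exp (-s * distSqColSpan B z)) ∂(Measure.pi fun _ => complexGaussian v)
      = ENNReal.ofReal ((1 + s * v)⁻¹ ^ (N - B.rank)) := by
  rw [← finrank_colSpan, ← finrank_colSpan_orthogonal]
  exact lintegral_exp_neg_mul_norm_starProjection_sq v s h _

end colSpan

/-! ### Independence of the chosen columns and the remaining observation. -/

/-- The contribution to the observation of the noise and of the columns with index outside `J`. -/
def outerObservation {N M : ℕ} (J : Finset (Fin M)) (x : Fin M → ℂ) (A : Fin N → Fin M → ℂ)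
    (n : Fin N → ℂ) : Fin N → ℂ :=
  fun r => ∑ i : {i // i ∉ J}, A r i * x i + n r

lemma residual_observation {N M : ℕ} (J : Finset (Fin M)) (x : Fin M → ℂ)
    (A : Matrix (Fin N) (Fin M) ℂ) (n : Fin N → ℂ) :
    residual A J (observation A x n) = distSqColSpan (columns A J) (outerObservation J x A n) := by
  rw [residual_eq, ← distSqColSpan_mulVec_add (columns A J) (fun j => x j) (outerObservation J x A n)]
  congr 1
  ext r
  simp only [observation, outerObservation, Pi.add_apply, Matrix.mulVec, dotProduct, columns,
    Matrix.submatrix_apply, id]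
  rw [← add_assoc]
  congr 1
  convert! (Fintype.sum_subtype_add_sum_subtype (· ∈ J) fun i => A r i * x i).symm

/-- The columns with index in `J` are independent of the rest of the observation, which is a
Gaussian vector. -/
lemma measurePreserving_columns_outerObservation {N M : ℕ} (J : Finset (Fin M)) (x : Fin M → ℂ)
    (v : ℝ≥0) :
    MeasurePreserving
      (fun p : (Fin N → Fin M → ℂ) × (Fin N → ℂ) =>
        ((fun r (j : J) => p.1 r j : Fin N → J → ℂ), outerObservation J x p.1 p.2))
      ((matrixLaw N M).prod (Measure.pi fun _ => complexGaussian v))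
      ((Measure.pi fun _ => Measure.pi fun _ => complexGaussian 1).prod
        (Measure.pi fun _ => complexGaussian (v + ∑ i : {i // i ∉ J}, ‖x i‖₊ ^ 2))) := by
  -- Within one row, split the entries into those in `J` and the others, then merge the latter with
  -- the noise. Rows are independent, so the product over rows finishes.
  have h0 : MeasurePreserving (MeasurableEquiv.piEquivPiSubtypeProd (fun _ : Fin M => ℂ) (· ∈ J))
      (Measure.pi fun _ => complexGaussian 1)
      ((Measure.pi fun _ : J => complexGaussian 1).prod
        (Measure.pi fun _ : {i // i ∉ J} => complexGaussian 1)) := by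
    convert! measurePreserving_piEquivPiSubtypeProd (fun _ : Fin M => complexGaussian 1) (· ∈ J)
  have h1 := h0.prod (MeasurePreserving.id (complexGaussian v))
  have h2 := (measurePreserving_prodAssoc (Measure.pi fun _ : J => complexGaussian 1)
    (Measure.pi fun _ : {i // i ∉ J} => complexGaussian 1) (complexGaussian v)).comp h1
  have h3 := (MeasurePreserving.id (Measure.pi fun _ : J => complexGaussian 1)).prod
    (measurePreserving_sum_mul_add (fun i : {i // i ∉ J} => x i) v)
  have h4 := measurePreserving_pi (fun _ : Fin N => _) (fun _ => _) (fun _ : Fin N => h3.comp h2)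
  have h5 := (measurePreserving_arrowProdEquivProdArrow (Fin M → ℂ) ℂ (Fin N)
    (fun _ => Measure.pi fun _ => complexGaussian 1) (fun _ => complexGaussian v)).symm
  have h6 := measurePreserving_arrowProdEquivProdArrow (J → ℂ) ℂ (Fin N)
    (fun _ => Measure.pi fun _ => complexGaussian 1)
    (fun _ => complexGaussian (v + ∑ i : {i // i ∉ J}, ‖x i‖₊ ^ 2))
  exact h6.comp (h4.comp h5)

lemma measurable_residual_observation {N M : ℕ} (J : Finset (Fin M)) (x : Fin M → ℂ) :
    Measurable fun p : (Fin N → Fin M → ℂ) × (Fin N → ℂ) =>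
      residual (Matrix.of p.1) J (observation (Matrix.of p.1) x p.2) := by
  simp_rw [residual_observation]
  have h1 := (measurePreserving_columns_outerObservation (N := N) J x 0).measurable
  have h2 := (measurable_distSqColSpan (N := N) (κ := J)).comp h1
  exact h2

/-- The variance of the coordinates of the part of the observation outside the span of the columns
with index in `J`. -/
def outerVariance {M : ℕ} (ν : ℝ) (J : Finset (Fin M)) (x : Fin M → ℂ) : ℝ :=
  ν ^ 2 + ∑ i : {i // i ∉ J}, ‖x i‖ ^ 2

/-- Condition on `A_J`. Its rank is at most `|J|`, so for `s ≥ 0` a rank defect only raises the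
exponent `N - rank` and helps; no rank assumption is needed. -/
lemma lintegral_exp_neg_mul_residual_le {N M : ℕ} (J : Finset (Fin M)) (x : Fin M → ℂ) (ν s : ℝ)
    (hs : 0 ≤ s) :
    ∫⁻ A, ∫⁻ n, ENNReal.ofReal (Real.exp (-s * residual (Matrix.of A) J
      (observation (Matrix.of A) x n))) ∂noiseLaw ν N ∂matrixLaw N M
      ≤ ENNReal.ofReal ((1 + s * outerVariance ν J x)⁻¹ ^ (N - J.card)) := by
  set v := Real.toNNReal (ν ^ 2) + ∑ i : {i // i ∉ J}, ‖x i‖₊ ^ 2 with hv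
  have hv' : (v : ℝ) = outerVariance ν J x := by
    simp [hv, outerVariance, Real.coe_toNNReal _ (sq_nonneg ν)]
  rw [← hv']
  have hm : Measurable fun q : (Fin N → J → ℂ) × (Fin N → ℂ) =>
      ENNReal.ofReal (Real.exp (-s * distSqColSpan (Matrix.of q.1) q.2)) :=
    ((measurable_distSqColSpan.const_mul _).exp).ennreal_ofReal
  have hm' : Measurable fun p : (Fin N → Fin M → ℂ) × (Fin N → ℂ) => ENNReal.ofReal (Real.exp
      (-s * residual (Matrix.of p.1) J (observation (Matrix.of p.1) x p.2))) :=
    (((measurable_residual_observation J x).const_mul _).exp).ennreal_ofReal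
  rw [noiseLaw, lintegral_lintegral hm'.aemeasurable]
  simp_rw [residual_observation]
  refine ((measurePreserving_columns_outerObservation (N := N) J x
    (Real.toNNReal (ν ^ 2))).lintegral_comp hm).trans_le ?_
  rw [lintegral_prod _ hm.aemeasurable]
  refine (lintegral_mono (g := fun _ => ENNReal.ofReal ((1 + s * v)⁻¹ ^ (N - J.card)))
    fun B => ?_).trans (by simp)
  refine (lintegral_exp_neg_mul_distSqColSpan v s (by positivity) (Matrix.of B)).trans_le ?_
  refine ENNReal.ofReal_le_ofReal (pow_le_pow_of_le_one (by positivity) ?_ ?_)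
  · exact inv_le_one_of_one_le₀ (by nlinarith [mul_nonneg hs v.2])
  · rw [← finrank_colSpan]
    have := finrank_colSpan_le (Matrix.of B)
    simp only [Fintype.card_coe] at this
    omega

/-- Here only noise survives the projection. The exact rank gives an equality, valid also for
negative `s`, as the upper tail requires. -/
lemma lintegral_exp_neg_mul_residual_of_rank {N M : ℕ} {I : Finset (Fin M)} {x : Fin M → ℂ}
    (hx : ∀ i ∉ I, x i = 0) (ν s : ℝ) (hs : 0 < 1 + s * ν ^ 2) {A : Matrix (Fin N) (Fin M) ℂ}
    (hA : (columns A I).rank = I.card) :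
    ∫⁻ n, ENNReal.ofReal (Real.exp (-s * residual A I (observation A x n))) ∂noiseLaw ν N
      = ENNReal.ofReal ((1 + s * ν ^ 2)⁻¹ ^ (N - I.card)) := by
  have h (n : Fin N → ℂ) : outerObservation I x A n = n := by
    ext r
    have : ∑ i : {i // i ∉ I}, A r i * x i = 0 :=
      Finset.sum_eq_zero fun i _ => by rw [hx i i.2, mul_zero]
    change ∑ i : {i // i ∉ I}, A r i * x i + n r = n r
    rw [this, zero_add]
  have hv := Real.coe_toNNReal _ (sq_nonneg ν)
  simp_rw [residual_observation, h, noiseLaw]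
  rw [lintegral_exp_neg_mul_distSqColSpan _ s (by rwa [hv]), hA, hv]

/-! ### Exponential Markov inequalities and almost sure full rank. -/

lemma measure_le_le_exp_mul_lintegral {Ω : Type*} [MeasurableSpace Ω] (P : Measure Ω) {X : Ω → ℝ}
    (hX : Measurable X) (a : ℝ) {s : ℝ} (hs : 0 ≤ s) :
    P {ω | X ω ≤ a} ≤
      ENNReal.ofReal (Real.exp (s * a)) * ∫⁻ ω, ENNReal.ofReal (Real.exp (-s * X ω)) ∂P := by
  rw [← lintegral_const_mul _ (by fun_prop)]
  refine meas_le_lintegral₀ (by fun_prop) fun ω hω => ?_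
  rw [← ENNReal.ofReal_mul (by positivity), ← Real.exp_add, ENNReal.one_le_ofReal,
    Real.one_le_exp_iff]
  nlinarith [mul_le_mul_of_nonneg_left (show X ω ≤ a from hω) hs]

lemma measure_ge_le_exp_mul_lintegral {Ω : Type*} [MeasurableSpace Ω] (P : Measure Ω) {X : Ω → ℝ}
    (hX : Measurable X) (a : ℝ) {s : ℝ} (hs : s ≤ 0) :
    P {ω | a ≤ X ω} ≤
      ENNReal.ofReal (Real.exp (s * a)) * ∫⁻ ω, ENNReal.ofReal (Real.exp (-s * X ω)) ∂P := by
  have := measure_le_le_exp_mul_lintegral P hX.neg (-a) (neg_nonneg.2 hs)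
  simpa using this

lemma complexGaussian_zero : complexGaussian 0 = Measure.dirac 0 := by
  rw [complexGaussian, zero_div, gaussianReal_zero_var, Measure.dirac_prod_dirac,
    Measure.map_dirac' measurable_complex_mk]
  rfl

lemma ae_noiseLaw_zero (N : ℕ) : ∀ᵐ n ∂noiseLaw 0 N, n = 0 := by
  have h (r : Fin N) : ∀ᵐ n ∂noiseLaw 0 N, n r = 0 := by
    refine (measurePreserving_eval (fun _ : Fin N => complexGaussian (Real.toNNReal (0 ^ 2)))
      r).quasiMeasurePreserving.ae (p := fun z => z = 0) ?_
    simp [complexGaussian_zero, ae_dirac_eq]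
  filter_upwards [ae_all_iff.2 h] with n hn
  exact funext hn

/-- A column of a Gaussian matrix is almost surely not in the span of fewer than `N` others. -/
lemma ae_residual_col_ne_zero {N M : ℕ} {J : Finset (Fin M)} {j : Fin M} (hj : j ∉ J)
    (hJ : J.card < N) :
    ∀ᵐ A ∂matrixLaw N M, residual (Matrix.of A) J ((Matrix.of A).col j) ≠ 0 := by
  have hobs (A : Fin N → Fin M → ℂ) :
      observation (Matrix.of A) (Pi.single j 1) 0 = (Matrix.of A).col j := by
    rw [observation, Matrix.mulVec_single_one, add_zero]
  have hm : Measurable fun A : Fin N → Fin M → ℂ => residual (Matrix.of A) J ((Matrix.of A).col j) := by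
    have h := (measurable_residual_observation (N := N) J (Pi.single j (1 : ℂ))).comp
      (measurable_id.prodMk measurable_const : Measurable fun A : Fin N → Fin M → ℂ =>
        (A, (0 : Fin N → ℂ)))
    simpa only [Function.comp_def, id, hobs] using h
  have hvar : 1 ≤ outerVariance 0 J (Pi.single j (1 : ℂ)) := by
    have := Finset.single_le_sum (f := fun i : {i // i ∉ J} =>
      ‖(Pi.single j (1 : ℂ) : Fin M → ℂ) i‖ ^ 2) (fun i _ => by positivity)
      (Finset.mem_univ ⟨j, hj⟩)
    simp only [Pi.single_eq_same, norm_one, one_pow] at this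
    rw [outerVariance]
    linarith
  -- Column `j` is the noiseless observation of the unit vector `e_j`. The transform bound has
  -- exponent `N - |J| ≥ 1`, giving `1/(s+1)`; then `s → ∞`.
  have hbound (s : ℕ) : matrixLaw N M {A | residual (Matrix.of A) J ((Matrix.of A).col j) ≤ 0}
      ≤ ENNReal.ofReal (1 / ((s : ℝ) + 1)) := by
    refine (measure_le_le_exp_mul_lintegral _ hm 0 (Nat.cast_nonneg s)).trans ?_
    rw [mul_zero, Real.exp_zero, ENNReal.ofReal_one, one_mul]
    have h1 := lintegral_exp_neg_mul_residual_le (N := N) J (Pi.single j (1 : ℂ)) 0 s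
      (Nat.cast_nonneg s)
    have h2 (A : Fin N → Fin M → ℂ) : ∫⁻ n, ENNReal.ofReal (Real.exp (-s * residual (Matrix.of A) J
        (observation (Matrix.of A) (Pi.single j (1 : ℂ)) n))) ∂noiseLaw 0 N
        = ENNReal.ofReal (Real.exp (-s * residual (Matrix.of A) J ((Matrix.of A).col j))) := by
      rw [lintegral_congr_ae (g := fun _ => ENNReal.ofReal (Real.exp (-s *
        residual (Matrix.of A) J ((Matrix.of A).col j))))]
      · simp
      · filter_upwards [ae_noiseLaw_zero N] with n hn
        rw [hn, hobs]
    simp_rw [h2] at h1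
    refine h1.trans (ENNReal.ofReal_le_ofReal ?_)
    have h3 : (0 : ℝ) < 1 + s * outerVariance 0 J (Pi.single j (1 : ℂ)) := by positivity
    have h4 : (s : ℝ) + 1 ≤ 1 + s * outerVariance 0 J (Pi.single j (1 : ℂ)) := by
      nlinarith [(Nat.cast_nonneg s : (0 : ℝ) ≤ s)]
    have h5 : (1 + s * outerVariance 0 J (Pi.single j (1 : ℂ)))⁻¹ ≤ 1 :=
      inv_le_one_of_one_le₀ (by linarith [(Nat.cast_nonneg s : (0 : ℝ) ≤ s)])
    refine (pow_le_of_le_one (by positivity) h5 (by omega)).trans ?_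
    rw [← one_div]
    exact one_div_le_one_div_of_le (by positivity) h4
  have hzero : matrixLaw N M {A | residual (Matrix.of A) J ((Matrix.of A).col j) ≤ 0} = 0 := by
    have := ENNReal.tendsto_ofReal (tendsto_one_div_add_atTop_nhds_zero_nat (𝕜 := ℝ))
    rw [ENNReal.ofReal_zero] at this
    exact le_antisymm (ge_of_tendsto' this hbound) zero_le
  filter_upwards [measure_eq_zero_iff_ae_notMem.1 hzero] with A hA h
  exact hA (le_of_eq h)

/-- Up to `N` columns of a Gaussian matrix are almost surely linearly independent. -/
lemma ae_rank_columns {N M : ℕ} {I : Finset (Fin M)} (hI : I.card ≤ N) :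
    ∀ᵐ A ∂matrixLaw N M, (columns (Matrix.of A) I).rank = I.card := by
  have h : ∀ᵐ A ∂matrixLaw N M, ∀ j : I,
      residual (Matrix.of A) (I.erase j) ((Matrix.of A).col j) ≠ 0 :=
    ae_all_iff.2 fun j => ae_residual_col_ne_zero (Finset.notMem_erase _ _)
      ((Finset.card_erase_lt_of_mem j.2).trans_le hI)
  filter_upwards [h] with A hA
  rw [← finrank_colSpan, colSpan, finrank_span_eq_card, Fintype.card_coe]
  rw [linearIndependent_iff_notMem_span]
  intro j hj
  refine hA j ?_
  have hle : Submodule.span ℂ ((fun i : I => WithLp.toLp 2 ((columns (Matrix.of A) I).col i)) ''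
      (Set.univ \ {j})) ≤ colSpan (columns (Matrix.of A) (I.erase j)) := by
    refine Submodule.span_mono ?_
    rintro _ ⟨i, hi, rfl⟩
    have hij : (i : Fin M) ≠ j := fun h => hi.2 (Subtype.ext h)
    exact ⟨⟨i, Finset.mem_erase.2 ⟨hij, i.2⟩⟩, rfl⟩
  rw [residual_eq, distSqColSpan, (Submodule.starProjection_apply_eq_zero_iff _).2]
  · simp
  · rw [Submodule.orthogonal_orthogonal]
    exact hle hj


/-! ### Chernoff bounds for the residual. -/

/-- The rate function in the Chernoff bound for a normalized chi-square variable. -/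
def rate (r : ℝ) : ℝ := r - 1 - Real.log r

/-- Inserting `v = u - u²/4` in `1 + v + v²/2 ≤ exp v` gives `log (1 + u) ≤ u - u²/4`. -/
lemma sq_div_four_le_rate_one_add {u : ℝ} (h0 : 0 ≤ u) (h1 : u ≤ 1) : u ^ 2 / 4 ≤ rate (1 + u) := by
  have hv : 0 ≤ u - u ^ 2 / 4 := by nlinarith
  have h := Real.quadratic_le_exp_of_nonneg hv
  have h2 : 1 + u ≤ Real.exp (u - u ^ 2 / 4) := by nlinarith [sq_nonneg (u - u ^ 2 / 4), sq_nonneg u]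
  have h3 := Real.log_le_log (by linarith) h2
  rw [Real.log_exp] at h3
  rw [rate]
  linarith

/-- Keep two terms of the series `-log r = ∑ (1-r)^n / n`. -/
lemma sq_div_four_le_rate {r : ℝ} (h0 : 0 < r) (h1 : r ≤ 1) : (1 - r) ^ 2 / 4 ≤ rate r := by
  have h := sum_le_hasSum (Finset.range 2) (fun i _ => by
    have : 0 ≤ 1 - r := by linarith
    positivity) (Real.hasSum_pow_div_log_of_abs_lt_one (x := 1 - r) (by
      rw [abs_of_nonneg (by linarith)]; linarith))
  norm_num [Finset.sum_range_succ] at h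
  rw [rate]
  nlinarith [sq_nonneg (1 - r)]

lemma exp_mul_pow_eq_exp_neg_rate {r : ℝ} (hr : 0 < r) (d : ℕ) :
    Real.exp ((1 - r) * d) * r ^ d = Real.exp (-(d * rate r)) := by
  have : r ^ d = Real.exp (d * Real.log r) := by
    rw [mul_comm, Real.exp_mul, Real.exp_log hr, Real.rpow_natCast]
  rw [this, ← Real.exp_add, rate]
  congr 1
  ring

lemma lintegral_noiseLaw_residual_le {N M : ℕ} (J : Finset (Fin M)) (x : Fin M → ℂ) (ν : ℝ)
    (hσ : 0 < outerVariance ν J x) {r : ℝ} (h0 : 0 < r) (h1 : r ≤ 1) :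
    ∫⁻ A, noiseLaw ν N {n | residual (Matrix.of A) J (observation (Matrix.of A) x n)
      ≤ r * ((N - J.card : ℕ) * outerVariance ν J x)} ∂matrixLaw N M
      ≤ ENNReal.ofReal (Real.exp (-((N - J.card : ℕ) * rate r))) := by
  set σ := outerVariance ν J x
  set d := N - J.card with hd
  -- The minimizer of `exp(s r d σ) (1 + sσ)⁻ᵈ`, determined by `1 + sσ = r⁻¹`.
  set s := (r⁻¹ - 1) / σ with hs'
  have hs : 0 ≤ s := div_nonneg (by linarith [(one_le_inv₀ h0).2 h1]) hσ.le
  have hsσ : 1 + s * σ = r⁻¹ := by rw [hs']; field_simp; ring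
  have hsa : s * (r * (d * σ)) = (1 - r) * d := by rw [hs']; field_simp
  calc _ ≤ ∫⁻ A, ENNReal.ofReal (Real.exp (s * (r * (d * σ)))) *
        ∫⁻ n, ENNReal.ofReal (Real.exp (-s * residual (Matrix.of A) J
          (observation (Matrix.of A) x n))) ∂noiseLaw ν N ∂matrixLaw N M :=
        lintegral_mono fun A => measure_le_le_exp_mul_lintegral _
          ((measurable_residual_observation J x).comp measurable_prodMk_left) _ hs
    _ = ENNReal.ofReal (Real.exp (s * (r * (d * σ)))) *
        ∫⁻ A, ∫⁻ n, ENNReal.ofReal (Real.exp (-s * residual (Matrix.of A) J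
          (observation (Matrix.of A) x n))) ∂noiseLaw ν N ∂matrixLaw N M :=
        lintegral_const_mul' _ _ ENNReal.ofReal_ne_top
    _ ≤ ENNReal.ofReal (Real.exp (s * (r * (d * σ)))) *
        ENNReal.ofReal ((1 + s * σ)⁻¹ ^ d) := by
        gcongr
        exact lintegral_exp_neg_mul_residual_le J x ν s hs
    _ = _ := by
        rw [← ENNReal.ofReal_mul (by positivity), hsσ, inv_inv, hsa, exp_mul_pow_eq_exp_neg_rate h0]

/-- One optimized identity serves both tails: the Chernoff parameter `(r⁻¹ - 1)/ν²` is nonnegative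
for `r ≤ 1` and nonpositive for `r ≥ 1`. -/
lemma noiseLaw_residual_of_rank {N M : ℕ} {I : Finset (Fin M)} {x : Fin M → ℂ}
    (hx : ∀ i ∉ I, x i = 0) {ν : ℝ} (hν : 0 < ν) {A : Fin N → Fin M → ℂ}
    (hA : (columns (Matrix.of A) I).rank = I.card) {r : ℝ} (h0 : 0 < r) :
    ENNReal.ofReal (Real.exp ((r⁻¹ - 1) / ν ^ 2 * (r * ((N - I.card : ℕ) * ν ^ 2)))) *
      ∫⁻ n, ENNReal.ofReal (Real.exp (-((r⁻¹ - 1) / ν ^ 2) * residual (Matrix.of A) I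
        (observation (Matrix.of A) x n))) ∂noiseLaw ν N
      = ENNReal.ofReal (Real.exp (-((N - I.card : ℕ) * rate r))) := by
  have hsσ : 1 + (r⁻¹ - 1) / ν ^ 2 * ν ^ 2 = r⁻¹ := by field_simp; ring
  have hsa : (r⁻¹ - 1) / ν ^ 2 * (r * ((N - I.card : ℕ) * ν ^ 2)) = (1 - r) * (N - I.card : ℕ) := by
    field_simp
  rw [lintegral_exp_neg_mul_residual_of_rank hx ν _ (by rw [hsσ]; positivity) hA,
    ← ENNReal.ofReal_mul (by positivity), hsσ, inv_inv, hsa, exp_mul_pow_eq_exp_neg_rate h0]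

lemma noiseLaw_residual_le_of_rank {N M : ℕ} {I : Finset (Fin M)} {x : Fin M → ℂ}
    (hx : ∀ i ∉ I, x i = 0) {ν : ℝ} (hν : 0 < ν) {A : Fin N → Fin M → ℂ}
    (hA : (columns (Matrix.of A) I).rank = I.card) {r : ℝ} (h0 : 0 < r) (h1 : r ≤ 1) :
    noiseLaw ν N {n | residual (Matrix.of A) I (observation (Matrix.of A) x n)
      ≤ r * ((N - I.card : ℕ) * ν ^ 2)}
      ≤ ENNReal.ofReal (Real.exp (-((N - I.card : ℕ) * rate r))) := by
  rw [← noiseLaw_residual_of_rank hx hν hA h0]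
  exact measure_le_le_exp_mul_lintegral _ ((measurable_residual_observation I x).comp
    measurable_prodMk_left) _ (div_nonneg (by linarith [(one_le_inv₀ h0).2 h1]) (by positivity))

lemma noiseLaw_residual_ge_of_rank {N M : ℕ} {I : Finset (Fin M)} {x : Fin M → ℂ}
    (hx : ∀ i ∉ I, x i = 0) {ν : ℝ} (hν : 0 < ν) {A : Fin N → Fin M → ℂ}
    (hA : (columns (Matrix.of A) I).rank = I.card) {r : ℝ} (h1 : 1 ≤ r) :
    noiseLaw ν N {n | r * ((N - I.card : ℕ) * ν ^ 2) ≤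
      residual (Matrix.of A) I (observation (Matrix.of A) x n)}
      ≤ ENNReal.ofReal (Real.exp (-((N - I.card : ℕ) * rate r))) := by
  rw [← noiseLaw_residual_of_rank hx hν hA (by linarith)]
  exact measure_ge_le_exp_mul_lintegral _ ((measurable_residual_observation I x).comp
    measurable_prodMk_left) _ (div_nonpos_of_nonpos_of_nonneg
      (by linarith [inv_le_one_of_one_le₀ h1]) (by positivity))

/-! ### The union bound and the count of wrong supports. -/

lemma typicalityDecoder_eq_some {N M : ℕ} {ν δ : ℝ} {L : ℕ} {A : Matrix (Fin N) (Fin M) ℂ}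
    {y : Fin N → ℂ} {I : Finset (Fin M)} (hI : JointlyTypical ν δ L A y I)
    (h : ∀ J, J ≠ I → ¬ JointlyTypical ν δ L A y J) :
    typicalityDecoder N M ν δ L A y = some I := by
  have hex : ∃! J : Finset (Fin M), JointlyTypical ν δ L A y J :=
    ⟨I, hI, fun J hJ => by_contra fun hne => h J hne hJ⟩
  rw [typicalityDecoder, dif_pos hex]
  exact congrArg some (hex.unique hex.choose_spec.1 hI)

lemma mem_supp {M : ℕ} {x : Fin M → ℂ} {i : Fin M} : i ∈ supp x ↔ x i ≠ 0 := by
  simp [supp]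

lemma minAbs_nonneg {M : ℕ} (x : Fin M → ℂ) : 0 ≤ minAbs x :=
  Real.iInf_nonneg fun _ => norm_nonneg _

lemma minAbs_le {M : ℕ} {x : Fin M → ℂ} {i : Fin M} (hi : i ∈ supp x) : minAbs x ≤ ‖x i‖ :=
  ciInf_le (f := fun i : supp x => ‖x i‖) (Set.finite_range _).bddBelow ⟨i, hi⟩

lemma le_outerVariance {M : ℕ} (ν : ℝ) (J : Finset (Fin M)) (x : Fin M → ℂ) :
    ν ^ 2 + (supp x \ J).card * minAbs x ^ 2 ≤ outerVariance ν J x := by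
  have h1 : ((supp x \ J).card : ℝ) * minAbs x ^ 2 ≤ ∑ i ∈ supp x \ J, ‖x i‖ ^ 2 := by
    rw [← nsmul_eq_mul]
    refine Finset.card_nsmul_le_sum _ _ _ fun i hi => ?_
    exact pow_le_pow_left₀ (minAbs_nonneg x) (minAbs_le (Finset.mem_sdiff.1 hi).1) 2
  have h2 : ∑ i ∈ supp x \ J, ‖x i‖ ^ 2 ≤ ∑ i ∈ Finset.univ.filter (· ∉ J), ‖x i‖ ^ 2 :=
    Finset.sum_le_sum_of_subset_of_nonneg
      (fun i hi => by simpa using (Finset.mem_sdiff.1 hi).2) fun i _ _ => by positivity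
  have h3 : ∑ i : {i // i ∉ J}, ‖x i‖ ^ 2 = ∑ i ∈ Finset.univ.filter (· ∉ J), ‖x i‖ ^ 2 :=
    (Finset.sum_subtype (Finset.univ.filter (· ∉ J)) (by simp) fun i => ‖x i‖ ^ 2).symm
  rw [outerVariance, h3]
  linarith

/-- The ratio between the acceptance level of the decoder and the variance outside a set of columns
that misses `k` elements of the support. -/
def levelRatio (ν ζ μ : ℝ) (k : ℕ) : ℝ := (ν ^ 2 + ζ * μ ^ 2) / (ν ^ 2 + k * μ ^ 2)

lemma levelRatio_pos {ν ζ : ℝ} (hν : 0 < ν) (hζ : 0 < ζ) (μ : ℝ) (k : ℕ) :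
    0 < levelRatio ν ζ μ k := by
  unfold levelRatio
  positivity

lemma levelRatio_le_one {ν ζ : ℝ} (hν : 0 < ν) (hζ1 : ζ < 1) (μ : ℝ) {k : ℕ}
    (hk : 1 ≤ k) : levelRatio ν ζ μ k ≤ 1 := by
  have hk' : (1 : ℝ) ≤ k := by exact_mod_cast hk
  unfold levelRatio
  rw [div_le_one (by positivity)]
  nlinarith [sq_nonneg μ, mul_le_mul_of_nonneg_right (hζ1.le.trans hk') (sq_nonneg μ)]

/-- The union bound for the joint-typicality decoder. -/
lemma errorProb_le_sum {N M : ℕ} {ν ζ u : ℝ} (hν : 0 < ν) (hζ : 0 < ζ) (hζ1 : ζ < 1)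
    (x : Fin M → ℂ) (hLN : (supp x).card < N) (hu0 : 0 ≤ u) (hu1 : u < 1)
    (hu : u * ν ^ 2 ≤ ζ * minAbs x ^ 2) :
    errorProb (typicalityDecoder N M ν (threshold ζ (minAbs x) N (supp x).card) (supp x).card) ν x
      ≤ ENNReal.ofReal (2 * Real.exp (-((N - (supp x).card : ℕ) * (u ^ 2 / 4)))) +
        ∑ J ∈ (Finset.univ.powersetCard (supp x).card).erase (supp x),
          ENNReal.ofReal (Real.exp (-((N - (supp x).card : ℕ) *
            rate (levelRatio ν ζ (minAbs x) (supp x \ J).card)))) := by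
  set I := supp x with hI
  set L := I.card with hL
  set μ := minAbs x
  set d := N - L with hd
  set S := (Finset.univ.powersetCard L).erase I with hS
  have hN : (0 : ℝ) < N := by exact_mod_cast (Nat.zero_le _).trans_lt hLN
  have hdc : ((d : ℕ) : ℝ) = (N : ℝ) - L := by rw [hd, Nat.cast_sub hLN.le]
  have hd0 : (0 : ℝ) ≤ d := Nat.cast_nonneg d
  have hx : ∀ i ∉ I, x i = 0 := fun i hi => by simpa [hI, mem_supp] using hi
  have hthr : threshold ζ μ N L = ζ * μ ^ 2 * d / N := by rw [threshold, hdc]; ring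
  have hnoise : ((N : ℝ) - L) / N * ν ^ 2 = ν ^ 2 * d / N := by rw [hdc]; ring
  let R : (Fin N → Fin M → ℂ) → Finset (Fin M) → (Fin N → ℂ) → ℝ := fun A J n =>
    residual (Matrix.of A) J (observation (Matrix.of A) x n)
  have hconst : ENNReal.ofReal (Real.exp (-(d * rate (1 - u)))) +
      ENNReal.ofReal (Real.exp (-(d * rate (1 + u))))
      ≤ ENNReal.ofReal (2 * Real.exp (-(d * (u ^ 2 / 4)))) := by
    rw [← ENNReal.ofReal_add (by positivity) (by positivity), two_mul]
    refine ENNReal.ofReal_le_ofReal (add_le_add ?_ ?_)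
    · have := sq_div_four_le_rate (r := 1 - u) (by linarith) (by linarith)
      rw [sub_sub_cancel] at this
      gcongr
    · have := sq_div_four_le_rate_one_add hu0 hu1.le
      gcongr
  -- The true support is handled for almost every fixed `A`, using full rank; the wrong supports are
  -- averaged over `A` afterwards.
  have hae : ∀ᵐ A ∂matrixLaw N M,
      errorProbGiven (typicalityDecoder N M ν (threshold ζ μ N L) L) ν x (Matrix.of A) ≤
        ENNReal.ofReal (2 * Real.exp (-(d * (u ^ 2 / 4)))) +
        ∑ J ∈ S, noiseLaw ν N {n | R A J n ≤
          levelRatio ν ζ μ (I \ J).card * ((N - J.card : ℕ) * outerVariance ν J x)} := by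
    filter_upwards [ae_rank_columns (I := I) hLN.le] with A hA
    have hsub : {n | typicalityDecoder N M ν (threshold ζ μ N L) L (Matrix.of A)
        (observation (Matrix.of A) x n) ≠ some I} ⊆
        ({n | R A I n ≤ (1 - u) * ((N - I.card : ℕ) * ν ^ 2)} ∪
          {n | (1 + u) * ((N - I.card : ℕ) * ν ^ 2) ≤ R A I n}) ∪
        ⋃ J ∈ S, {n | R A J n ≤
          levelRatio ν ζ μ (I \ J).card * ((N - J.card : ℕ) * outerVariance ν J x)} := by
      intro n hn
      by_contra hcon
      simp only [Set.mem_union, Set.mem_iUnion, Set.mem_ofPred_eq, not_or, not_exists, not_le]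
        at hcon
      obtain ⟨⟨h1, h2⟩, h3⟩ := hcon
      refine hn (typicalityDecoder_eq_some ⟨rfl, hA, ?_⟩ ?_)
      · change |1 / (N : ℝ) * R A I n - _| < _
        rw [hnoise, hthr, one_div_mul_eq_div, ← sub_div, abs_div, abs_of_pos hN,
          div_lt_div_iff_of_pos_right hN, abs_lt]
        have := mul_le_mul_of_nonneg_right hu hd0
        constructor <;> nlinarith
      -- Dropping the rank condition for a wrong `J` only enlarges the error event.
      · rintro J hJ ⟨hJL, -, hJt⟩
        refine absurd ?_ (not_le.2 (h3 J (Finset.mem_erase.2 ⟨hJ, by simp [hJL]⟩)))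
        change |1 / (N : ℝ) * R A J n - _| < _ at hJt
        rw [hnoise, hthr, one_div_mul_eq_div, ← sub_div, abs_div, abs_of_pos hN,
          div_lt_div_iff_of_pos_right hN, abs_lt] at hJt
        have h4 := mul_le_mul_of_nonneg_left (le_outerVariance ν J x)
          (levelRatio_pos hν hζ μ (I \ J).card).le
        have h5 : levelRatio ν ζ μ (I \ J).card * (ν ^ 2 + (I \ J).card * μ ^ 2)
            = ν ^ 2 + ζ * μ ^ 2 := by
          unfold levelRatio
          field_simp
        rw [h5] at h4
        rw [hJL, ← hd]
        nlinarith [mul_le_mul_of_nonneg_right h4 hd0, hJt.2]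
    refine (measure_mono hsub).trans ((measure_union_le _ _).trans (add_le_add ?_
      (measure_biUnion_finset_le _ _)))
    exact ((measure_union_le _ _).trans (add_le_add
      (noiseLaw_residual_le_of_rank hx hν hA (by linarith) (by linarith))
      (noiseLaw_residual_ge_of_rank hx hν hA (by linarith)))).trans hconst
  refine (lintegral_mono_ae hae).trans ?_
  have hmeas (J : Finset (Fin M)) (a : ℝ) : Measurable fun A => noiseLaw ν N {n | R A J n ≤ a} :=
    measurable_measure_prodMk_left (s := {p | R p.1 J p.2 ≤ a})
      (measurableSet_le (measurable_residual_observation J x) measurable_const)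
  rw [lintegral_add_left measurable_const, lintegral_finsetSum _ fun J _ => hmeas J _]
  refine add_le_add (by simp) (Finset.sum_le_sum fun J hJ => ?_)
  obtain ⟨hJI, hJ⟩ := Finset.mem_erase.1 hJ
  have hJL : J.card = L := (Finset.mem_powersetCard.1 hJ).2
  have hk : 1 ≤ (I \ J).card := by
    rw [Nat.one_le_iff_ne_zero, Finset.card_ne_zero, Finset.sdiff_nonempty]
    exact fun h => hJI (Finset.eq_of_subset_of_card_le h hJL.le).symm
  have := lintegral_noiseLaw_residual_le (N := N) J x ν
    (lt_of_lt_of_le (by positivity) (le_outerVariance ν J x)) (levelRatio_pos hν hζ μ (I \ J).card)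
    (levelRatio_le_one hν hζ1 μ hk)
  rw [hJL] at this ⊢
  exact this

/-- `J` is determined by `I \ J` and `J \ I`, two sets of the same size `k`. -/
lemma card_filter_card_sdiff_le {M L : ℕ} {I : Finset (Fin M)} (hI : I.card = L) (k : ℕ) :
    ((Finset.univ.powersetCard L).filter fun J : Finset (Fin M) => (I \ J).card = k).card
      ≤ M ^ (2 * k) := by
  have h : ((Finset.univ.powersetCard L).filter fun J : Finset (Fin M) => (I \ J).card = k).card ≤
      ((Finset.univ.powersetCard k) ×ˢ (Finset.univ.powersetCard k) :
        Finset (Finset (Fin M) × Finset (Fin M))).card := by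
    refine Finset.card_le_card_of_injOn (fun J => (I \ J, J \ I)) ?_ ?_
    · intro J hJ
      simp only [Finset.coe_filter, Finset.mem_powersetCard, Set.mem_ofPred_eq] at hJ
      have : (J \ I).card = (I \ J).card := by
        rw [Finset.card_sdiff_comm (hI.trans hJ.1.2.symm)]
      simp [this, hJ.2]
    · intro J _ K _ h
      simp only [Prod.mk.injEq] at h
      ext i
      have h1 := congrArg (i ∈ ·) h.1
      have h2 := congrArg (i ∈ ·) h.2
      simp only [Finset.mem_sdiff, eq_iff_iff] at h1 h2
      tauto
  refine h.trans ?_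
  rw [Finset.card_product, Finset.card_powersetCard, Finset.card_univ, Fintype.card_fin, two_mul,
    pow_add]
  exact Nat.mul_le_mul (Nat.choose_le_pow _ _) (Nat.choose_le_pow _ _)

lemma sum_erase_powersetCard_le {M L : ℕ} {I : Finset (Fin M)} (hI : I.card = L) (f : ℕ → ℝ≥0∞) :
    ∑ J ∈ (Finset.univ.powersetCard L).erase I, f (I \ J).card
      ≤ ∑ k ∈ Finset.Icc 1 L, ((min (M ^ (2 * k)) (2 ^ M) : ℕ) : ℝ≥0∞) * f k := by
  have hmaps : ∀ J ∈ (Finset.univ.powersetCard L).erase I, (I \ J).card ∈ Finset.Icc 1 L := by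
    intro J hJ
    obtain ⟨hJI, hJ⟩ := Finset.mem_erase.1 hJ
    have hJL : J.card = L := (Finset.mem_powersetCard.1 hJ).2
    rw [Finset.mem_Icc, Nat.one_le_iff_ne_zero, Finset.card_ne_zero, Finset.sdiff_nonempty]
    refine ⟨fun h => hJI (Finset.eq_of_subset_of_card_le h (hJL.trans hI.symm).le).symm, ?_⟩
    exact (Finset.card_le_card Finset.sdiff_subset).trans hI.le
  rw [← Finset.sum_fiberwise_of_maps_to hmaps]
  refine Finset.sum_le_sum fun k _ => ?_
  rw [Finset.sum_congr rfl fun J hJ => by rw [(Finset.mem_filter.1 hJ).2], Finset.sum_const,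
    nsmul_eq_mul]
  gcongr
  refine le_min ((Finset.card_le_card (Finset.filter_subset_filter _
    (Finset.erase_subset _ _))).trans (card_filter_card_sdiff_le hI k)) ?_
  exact (Finset.card_le_univ _).trans (by simp)

lemma errorProb_le {N M : ℕ} {ν ζ u : ℝ} (hν : 0 < ν) (hζ : 0 < ζ) (hζ1 : ζ < 1)
    {L : ℕ} {x : Fin M → ℂ} (hL : (supp x).card = L) (hLN : L < N) (hu0 : 0 ≤ u) (hu1 : u < 1)
    (hu : u * ν ^ 2 ≤ ζ * minAbs x ^ 2) :
    errorProb (typicalityDecoder N M ν (threshold ζ (minAbs x) N L) L) ν x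
      ≤ ENNReal.ofReal (2 * Real.exp (-((N - L : ℕ) * (u ^ 2 / 4))) +
        ∑ k ∈ Finset.Icc 1 L, min ((M : ℝ) ^ (2 * k)) (2 ^ M) *
          Real.exp (-((N - L : ℕ) * rate (levelRatio ν ζ (minAbs x) k)))) := by
  subst hL
  refine (errorProb_le_sum hν hζ hζ1 x hLN hu0 hu1 hu).trans ?_
  rw [ENNReal.ofReal_add (by positivity) (by positivity),
    ENNReal.ofReal_sum_of_nonneg fun _ _ => by positivity]
  gcongr
  refine (sum_erase_powersetCard_le rfl fun k => ENNReal.ofReal (Real.exp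
    (-((N - (supp x).card : ℕ) * rate (levelRatio ν ζ (minAbs x) k))))).trans_eq ?_
  refine Finset.sum_congr rfl fun k _ => ?_
  rw [ENNReal.ofReal_mul (by positivity)]
  congr 1
  rw [← ENNReal.ofReal_natCast]
  push_cast
  rfl


/-! ### Lower bounds for the rate, by the number of missed elements. -/

lemma one_sub_levelRatio {ν ζ μ : ℝ} (hν : 0 < ν) (k : ℕ) :
    1 - levelRatio ν ζ μ k = (k - ζ) * μ ^ 2 / (ν ^ 2 + k * μ ^ 2) := by
  unfold levelRatio
  field_simp
  ring

/-- When noise dominates, `1 - r` is at least of order `kμ²/ν²`; its square is then weakened by `k²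
≥ k` to a bound linear in `k`, matching `log (M^(2k))`. -/
lemma le_rate_levelRatio_of_le {ν ζ μ : ℝ} (hν : 0 < ν) (hζ : 0 < ζ) (hζ1 : ζ < 1) {k : ℕ}
    (hk : 1 ≤ k) (hkμ : k * μ ^ 2 ≤ ν ^ 2) :
    (1 - ζ) ^ 2 / (16 * ν ^ 4) * (k * μ ^ 4) ≤ rate (levelRatio ν ζ μ k) := by
  have hk' : (1 : ℝ) ≤ k := by exact_mod_cast hk
  have h1 : (1 - ζ) * k * μ ^ 2 / (2 * ν ^ 2) ≤ 1 - levelRatio ν ζ μ k := by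
    rw [one_sub_levelRatio hν]
    apply div_le_div₀ _ _ (by positivity) (by linarith)
    · exact mul_nonneg (by linarith) (sq_nonneg _)
    · exact mul_le_mul_of_nonneg_right (by nlinarith) (sq_nonneg _)
  have h0 : 0 ≤ (1 - ζ) * k * μ ^ 2 / (2 * ν ^ 2) := by
    have : 0 < 1 - ζ := by linarith
    positivity
  refine le_trans ?_ (sq_div_four_le_rate (levelRatio_pos hν hζ μ k)
    (levelRatio_le_one hν hζ1 μ hk))
  calc (1 - ζ) ^ 2 / (16 * ν ^ 4) * (k * μ ^ 4)
      ≤ (1 - ζ) ^ 2 / (16 * ν ^ 4) * (k ^ 2 * μ ^ 4) := by gcongr; nlinarith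
    _ = ((1 - ζ) * k * μ ^ 2 / (2 * ν ^ 2)) ^ 2 / 4 := by field_simp; ring
    _ ≤ _ := by gcongr

lemma le_rate_levelRatio_of_ge {ν ζ μ : ℝ} (hν : 0 < ν) (hζ : 0 < ζ) (hζ1 : ζ < 1) {k : ℕ}
    (hk : 1 ≤ k) (hkμ : ν ^ 2 ≤ k * μ ^ 2) :
    (1 - ζ) ^ 2 / 16 ≤ rate (levelRatio ν ζ μ k) := by
  have hk' : (1 : ℝ) ≤ k := by exact_mod_cast hk
  have h1 : (1 - ζ) / 2 ≤ 1 - levelRatio ν ζ μ k := by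
    rw [one_sub_levelRatio hν, div_le_div_iff₀ (by norm_num) (by positivity)]
    have : (1 - ζ) * (ν ^ 2 + k * μ ^ 2) ≤ (1 - ζ) * (2 * (k * μ ^ 2)) :=
      mul_le_mul_of_nonneg_left (by linarith) (by linarith)
    have h2 : ζ * μ ^ 2 ≤ ζ * (k * μ ^ 2) :=
      mul_le_mul_of_nonneg_left (by nlinarith [sq_nonneg μ]) hζ.le
    nlinarith
  have h0 : 0 ≤ (1 - ζ) / 2 := by linarith
  refine le_trans ?_ (sq_div_four_le_rate (levelRatio_pos hν hζ μ k)
    (levelRatio_le_one hν hζ1 μ hk))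
  calc (1 - ζ) ^ 2 / 16 = ((1 - ζ) / 2) ^ 2 / 4 := by ring
    _ ≤ _ := by gcongr

/-- Since `μ² ≥ ℓ^(-1/2)`, one has `kμ² ≥ ℓ^(1/4)`, so the ratio is `O(ℓ^(-1/4))` and `-log r` makes
the rate unbounded. -/
lemma le_rate_levelRatio_of_rpow_le {ν ζ μ ℓ : ℝ} (hν : 0 < ν) (hζ : 0 < ζ) (hζ1 : ζ < 1) {k : ℕ}
    (hℓ : 1 ≤ ℓ) (hμ : 1 ≤ ℓ * μ ^ 4) (hk : ℓ ^ (3 / 4 : ℝ) ≤ k) :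
    Real.log ℓ / 4 - Real.log (ν ^ 2 + 1) - 1 ≤ rate (levelRatio ν ζ μ k) := by
  have hℓ0 : 0 < ℓ := by linarith
  have hr0 := levelRatio_pos hν hζ μ k
  have hsq : 1 ≤ ℓ ^ (1 / 2 : ℝ) * μ ^ 2 := by
    have h : (ℓ ^ (1 / 2 : ℝ)) ^ 2 = ℓ := by
      rw [← Real.rpow_natCast, ← Real.rpow_mul hℓ0.le]; norm_num
    refine (one_le_sq_iff₀ (by positivity)).1 ?_
    calc 1 ≤ ℓ * μ ^ 4 := hμ
      _ = (ℓ ^ (1 / 2 : ℝ)) ^ 2 * μ ^ 4 := by rw [h]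
      _ = _ := by ring
  have hμ0 : 0 < μ ^ 2 := by
    by_contra h
    have : μ ^ 2 = 0 := le_antisymm (not_lt.1 h) (sq_nonneg μ)
    rw [this] at hsq
    norm_num at hsq
  have hadd : ℓ ^ (3 / 4 : ℝ) = ℓ ^ (1 / 4 : ℝ) * ℓ ^ (1 / 2 : ℝ) := by
    rw [← Real.rpow_add hℓ0]; norm_num
  have h1ℓ : 1 ≤ ℓ ^ (1 / 2 : ℝ) := Real.one_le_rpow hℓ (by norm_num)
  have hr : levelRatio ν ζ μ k ≤ (ν ^ 2 + 1) / ℓ ^ (1 / 4 : ℝ) := by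
    unfold levelRatio
    rw [div_le_div_iff₀ (by positivity) (by positivity)]
    set a := ℓ ^ (1 / 4 : ℝ)
    set b := ℓ ^ (1 / 2 : ℝ)
    have ha : 0 < a := by positivity
    have h1 : a * b * μ ^ 2 ≤ k * μ ^ 2 := by rw [← hadd]; gcongr
    have h2 : a * 1 ≤ a * (b * μ ^ 2) := by gcongr
    have h3 : a * μ ^ 2 * 1 ≤ a * μ ^ 2 * b := by gcongr
    have h4 : ζ * (μ ^ 2 * a) ≤ 1 * (μ ^ 2 * a) := by gcongr
    have h5 : ν ^ 2 * a ≤ ν ^ 2 * (k * μ ^ 2) := by gcongr; linarith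
    nlinarith [sq_nonneg ν, mul_nonneg (sq_nonneg ν) (sq_nonneg ν)]
  have hlog := Real.log_le_log hr0 hr
  rw [Real.log_div (by positivity) (by positivity), Real.log_rpow hℓ0] at hlog
  rw [rate]
  linarith

lemma union_term_le {β ν ζ μ B : ℝ} {M L k d : ℕ} (hν : 0 < ν) (hζ : 0 < ζ)
    (hζ1 : ζ < 1) (hB : 0 ≤ B) (hM0 : 0 < M) (hL : 3 ≤ L) (hM : (M : ℝ) ≤ 2 * β * L)
    (hML : (M : ℝ) ≤ L ^ 2) (hd : L ≤ d) (hk : 1 ≤ k)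
    (h3 : (B + 6) * Real.log L ≤ (1 - ζ) ^ 2 / 16 * (L : ℝ) ^ (1 / 4 : ℝ))
    (h4 : 2 * β + 1 ≤ Real.log L / 4 - Real.log (ν ^ 2 + 1) - 1)
    (h5 : (B + 2) * Real.log L ≤ L)
    (hμ1 : 1 ≤ L * μ ^ 4)
    (hμ2 : (B + 6) * Real.log L ≤ (1 - ζ) ^ 2 / (16 * ν ^ 4) * (L * μ ^ 4)) :
    min ((M : ℝ) ^ (2 * k)) (2 ^ M) * Real.exp (-(d * rate (levelRatio ν ζ μ k)))
      ≤ Real.exp (-((B + 2) * Real.log L)) := by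
  have hL' : (3 : ℝ) ≤ L := by exact_mod_cast hL
  have hd' : (L : ℝ) ≤ d := by exact_mod_cast hd
  have hk' : (1 : ℝ) ≤ k := by exact_mod_cast hk
  have hlog : 0 ≤ Real.log L := Real.log_nonneg (by linarith)
  have hM0' : (0 : ℝ) < M := by exact_mod_cast hM0
  -- Above `L^(3/4)` the count `2^M` is used; below it `M^(2k) ≤ exp(4k log L)`, and the `B + 6` in
  -- the hypotheses leaves `(B + 2) k log L`.
  rcases le_total ((L : ℝ) ^ (3 / 4 : ℝ)) k with hkL | hkL
  · have hrate := h4.trans (le_rate_levelRatio_of_rpow_le hν hζ hζ1 (by linarith) hμ1 hkL)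
    have hpow : (2 : ℝ) ^ M ≤ Real.exp M := by
      rw [← mul_one (M : ℝ), Real.exp_nat_mul]
      gcongr
      linarith [Real.add_one_le_exp (1 : ℝ)]
    calc _ ≤ Real.exp M * Real.exp (-(d * rate (levelRatio ν ζ μ k))) := by
          gcongr
          exact (min_le_right _ _).trans hpow
      _ ≤ _ := by
          rw [← Real.exp_add, Real.exp_le_exp]
          have hβ : 0 ≤ 2 * β + 1 := by
            by_contra hneg
            nlinarith
          have : (L : ℝ) * (2 * β + 1) ≤ d * rate (levelRatio ν ζ μ k) :=
            mul_le_mul hd' hrate hβ (by positivity)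
          linarith
  · have hMk : (M : ℝ) ^ (2 * k) ≤ Real.exp (k * (4 * Real.log L)) := by
      rw [← Real.exp_log hM0', ← Real.exp_nat_mul, Real.exp_le_exp]
      have : Real.log M ≤ 2 * Real.log L := by
        have := Real.log_le_log hM0' hML
        rwa [Real.log_pow, Nat.cast_ofNat] at this
      push_cast
      nlinarith
    have hr : k * ((B + 6) * Real.log L) ≤ L * rate (levelRatio ν ζ μ k) := by
      rcases le_total (k * μ ^ 2) (ν ^ 2) with hkμ | hkμ
      · have := le_rate_levelRatio_of_le hν hζ hζ1 hk hkμ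
        calc _ ≤ k * ((1 - ζ) ^ 2 / (16 * ν ^ 4) * (L * μ ^ 4)) := by gcongr
          _ = L * ((1 - ζ) ^ 2 / (16 * ν ^ 4) * (k * μ ^ 4)) := by ring
          _ ≤ _ := by gcongr
      · have := le_rate_levelRatio_of_ge hν hζ hζ1 hk hkμ
        have hadd : (L : ℝ) ^ (3 / 4 : ℝ) * (L : ℝ) ^ (1 / 4 : ℝ) = L := by
          rw [← Real.rpow_add (by linarith)]; norm_num
        calc _ ≤ (L : ℝ) ^ (3 / 4 : ℝ) * ((1 - ζ) ^ 2 / 16 * (L : ℝ) ^ (1 / 4 : ℝ)) := by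
              gcongr
          _ = ((L : ℝ) ^ (3 / 4 : ℝ) * (L : ℝ) ^ (1 / 4 : ℝ)) * ((1 - ζ) ^ 2 / 16) := by ring
          _ ≤ _ := by rw [hadd]; gcongr
    have hrate0 : 0 ≤ rate (levelRatio ν ζ μ k) := by
      have h0 : 0 ≤ k * ((B + 6) * Real.log L) := by positivity
      by_contra hneg
      nlinarith
    calc _ ≤ Real.exp (k * (4 * Real.log L)) *
            Real.exp (-(d * rate (levelRatio ν ζ μ k))) := by
          gcongr
          exact (min_le_left _ _).trans hMk
      _ ≤ _ := by
          rw [← Real.exp_add, Real.exp_le_exp]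
          have h1 := mul_le_mul_of_nonneg_right hd' hrate0
          have h2 : 0 ≤ (k - 1) * ((B + 2) * Real.log L) :=
            mul_nonneg (by linarith) (by positivity)
          linarith

/-! ### Asymptotics in `M`. -/

lemma tendsto_sparsity {β : ℝ} (hβ : 0 < β) : Tendsto (sparsity β) atTop atTop :=
  tendsto_nat_floor_atTop.comp (tendsto_natCast_atTop_atTop.atTop_div_const hβ)

lemma le_mul_sparsity_add_one {β : ℝ} (hβ : 0 < β) (M : ℕ) :
    (M : ℝ) ≤ β * (sparsity β M + 1) := by
  have := (Nat.lt_floor_add_one ((M : ℝ) / β)).le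
  rw [div_le_iff₀ hβ] at this
  rw [sparsity]
  linarith

lemma eventually_mul_log_le {C c a : ℝ} (hc : 0 < c) (ha : 0 < a) :
    ∀ᶠ y : ℝ in atTop, C * Real.log y ≤ c * y ^ a := by
  have h := (isLittleO_log_rpow_atTop ha).def (c := c / (|C| + 1)) (by positivity)
  filter_upwards [h, eventually_ge_atTop 1] with y hy hy1
  have hlog := Real.log_nonneg hy1
  rw [Real.norm_of_nonneg hlog, Real.norm_of_nonneg (by positivity), div_mul_eq_mul_div,
    le_div_iff₀ (by positivity)] at hy
  nlinarith [le_abs_self C, abs_nonneg C]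

/-- The error probability decays faster than every power of `1 / L`. -/
lemma eventually_errorProb_le {β ν ζ : ℝ} (hβ : 0 < β) (hν : 0 < ν) (hζ : 0 < ζ) (hζ1 : ζ < 1)
    {x : ∀ M : ℕ, Fin M → ℂ} (hx : ∀ M, (supp (x M)).card = sparsity β M)
    (hμ : Tendsto (fun M : ℕ => (sparsity β M : ℝ) * minAbs (x M) ^ 4 /
      Real.log (sparsity β M)) atTop atTop)
    {N : ℕ → ℕ} (hN : ∀ᶠ M in atTop, 2 * sparsity β M < N M) {B : ℝ} (hB : 0 ≤ B) :
    ∀ᶠ M in atTop, errorProb (typicalityDecoder (N M) M ν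
      (threshold ζ (minAbs (x M)) (N M) (sparsity β M)) (sparsity β M)) ν (x M)
      ≤ ENNReal.ofReal (Real.exp (-(B * Real.log (sparsity β M)))) := by
  have hLt := tendsto_sparsity hβ
  have hLr : Tendsto (fun M => (sparsity β M : ℝ)) atTop atTop :=
    tendsto_natCast_atTop_atTop.comp hLt
  have hζ' : 0 < 1 - ζ := by linarith
  have e1 := hLr.eventually (eventually_ge_atTop (2 * β))
  have e2 := hLr.eventually (eventually_mul_log_le (C := B + 1) (c := 1 / 16) (a := 1)
    (by norm_num) one_pos)
  have e3 := hLr.eventually (eventually_mul_log_le (C := B + 6) (c := (1 - ζ) ^ 2 / 16)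
    (a := 1 / 4) (by positivity) (by norm_num))
  have e4 := (Real.tendsto_log_atTop.comp hLr).eventually
    (eventually_ge_atTop (4 * (2 * β + 1 + Real.log (ν ^ 2 + 1) + 1)))
  have e5 := hLr.eventually (eventually_mul_log_le (C := B + 2) (c := 1) (a := 1)
    one_pos one_pos)
  have e6 := hμ.eventually (eventually_ge_atTop 1)
  have e7 := hμ.eventually (eventually_ge_atTop ((B + 6) / ((1 - ζ) ^ 2 / (16 * ν ^ 4))))
  have e8 := hμ.eventually (eventually_ge_atTop ((B + 1) / (ζ ^ 2 / (4 * ν ^ 4))))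
  filter_upwards [hLt.eventually (eventually_ge_atTop 3), eventually_gt_atTop 0, hN, e1, e2, e3,
    e4, e5, e6, e7, e8] with M hL3 hM0 hNM e1 e2 e3 e4 e5 e6 e7 e8
  have hMβ := le_mul_sparsity_add_one hβ M
  have hxM := hx M
  set L := sparsity β M
  set μ := minAbs (x M) with hμdef
  have hL3' : (3 : ℝ) ≤ L := by exact_mod_cast hL3
  have hlog1 : 1 ≤ Real.log L := by
    rw [Real.le_log_iff_exp_le (by linarith)]
    linarith [Real.exp_one_lt_d9]
  rw [Real.rpow_one] at e2 e5
  rw [le_div_iff₀ (by linarith)] at e6 e7 e8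
  rw [div_mul_eq_mul_div, div_le_iff₀' (by positivity)] at e7 e8
  simp only [Function.comp_apply] at e4
  -- The largest relative deviation of the true residual within the threshold, capped to stay below
  -- 1.
  set u := min (ζ * μ ^ 2 / ν ^ 2) (1 / 2) with hu
  have hu0 : 0 ≤ u := le_min (by positivity) (by norm_num)
  have hu1 : u < 1 := (min_le_right _ _).trans_lt (by norm_num)
  have huν : u * ν ^ 2 ≤ ζ * μ ^ 2 := by
    rw [← le_div_iff₀ (by positivity)]
    exact min_le_left _ _
  have hd : L ≤ N M - L := by omega
  have hd' : (L : ℝ) ≤ (N M - L : ℕ) := by exact_mod_cast hd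
  refine (errorProb_le hν hζ hζ1 hxM (by omega) hu0 hu1 huν).trans (ENNReal.ofReal_le_ofReal ?_)
  have hfirst : Real.exp (-((N M - L : ℕ) * (u ^ 2 / 4))) ≤ Real.exp (-((B + 1) * Real.log L)) := by
    rw [Real.exp_le_exp, neg_le_neg_iff]
    refine le_trans ?_ (mul_le_mul_of_nonneg_right hd' (by positivity))
    rcases min_choice (ζ * μ ^ 2 / ν ^ 2) (1 / 2) with h | h
    · rw [hu, h]
      refine e8.trans_eq ?_
      field_simp
    · rw [hu, h]
      linarith
  have hterm : ∀ k ∈ Finset.Icc 1 L, min ((M : ℝ) ^ (2 * k)) (2 ^ M) *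
      Real.exp (-((N M - L : ℕ) * rate (levelRatio ν ζ μ k)))
      ≤ Real.exp (-((B + 2) * Real.log L)) := by
    intro k hk
    refine union_term_le (β := β) hν hζ hζ1 hB hM0 hL3 ?_ ?_ hd (Finset.mem_Icc.1 hk).1 e3
      (by linarith) (by linarith) (by linarith) e7
    · nlinarith
    · nlinarith
  have hsum := Finset.sum_le_card_nsmul _ _ _ hterm
  rw [Nat.card_Icc, Nat.add_sub_cancel, nsmul_eq_mul] at hsum
  have hexp (C : ℝ) : Real.exp (-(C * Real.log L)) = L * Real.exp (-((C + 1) * Real.log L)) := by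
    have : (L : ℝ) = Real.exp (Real.log L) := (Real.exp_log (by linarith)).symm
    conv_rhs => rw [this]
    rw [Real.log_exp, ← Real.exp_add]
    congr 1
    ring
  have h12 := hexp (B + 1)
  rw [show B + 1 + 1 = B + 2 by ring] at h12
  rw [hexp B]
  -- The two tails and the sum over `k` contribute at most `3 L^(-(B+1)) ≤ L^(-B)`, as `L ≥ 3`.
  have := mul_le_mul_of_nonneg_right hL3' (Real.exp_pos (-((B + 1) * Real.log L))).le
  linarith

lemma eventually_lt_of_dominates {β : ℝ} (hβ : 0 < β) {N : ℕ → ℕ}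
    (h : Dominates (fun M => (N M : ℝ)) (fun M => 2 * (sparsity β M : ℝ))) :
    ∀ᶠ M in atTop, 2 * sparsity β M < N M := by
  have hpos := (tendsto_sparsity hβ).eventually (eventually_ge_atTop 1)
  -- The degenerate case `f = g = 0` is impossible because the sparsity tends to infinity.
  rcases h with h | ⟨-, -, -, -, M₀, h⟩
  · obtain ⟨M, hM⟩ := hpos.exists
    have := (h M).2
    have : (1 : ℝ) ≤ sparsity β M := by exact_mod_cast hM
    linarith
  · filter_upwards [hpos, eventually_gt_atTop M₀] with M h1 h2
    have h1' : (1 : ℝ) ≤ sparsity β M := by exact_mod_cast h1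
    have := h M h2
    rw [one_lt_div (by positivity)] at this
    have : (2 : ℝ) * sparsity β M < N M := this
    exact_mod_cast this

/-- Monotonicity of the extended logarithm covers `p = 0` as well, where `log 0 = ⊥`. -/
lemma le_neg_log_div {p : ℝ≥0∞} {B ℓ : ℝ} (hℓ : 0 < ℓ)
    (hp : p ≤ ENNReal.ofReal (Real.exp (-(B * ℓ)))) :
    (B : EReal) ≤ -ENNReal.log p / (ℓ : EReal) := by
  rw [EReal.le_div_iff_mul_le (by exact_mod_cast hℓ) (EReal.coe_ne_top _), EReal.le_neg,
    ← EReal.coe_mul, ← EReal.coe_neg]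
  refine (ENNReal.log_monotone hp).trans_eq ?_
  rw [ENNReal.log_ofReal_of_pos (Real.exp_pos _), Real.log_exp]

end SparseRecovery

end

theorem theorem1 (β : ℝ) (hβ : 2 < β) :
    ∃ C₁ : ℝ, 1 < C₁ ∧
      ∀ (ν : ℝ), 0 < ν → ∀ (ζ : ℝ), 0 < ζ → ζ < 1 →
      ∀ (x : ∀ M : ℕ, Fin M → ℂ),
        (∀ M, (SparseRecovery.supp (x M)).card = SparseRecovery.sparsity β M) →
        Tendsto (fun M : ℕ => (SparseRecovery.sparsity β M : ℝ) *
            SparseRecovery.minAbs (x M) ^ 4 / Real.log (SparseRecovery.sparsity β M))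
          atTop atTop →
      ∀ (N : ℕ → ℕ),
        SparseRecovery.Dominates (fun M => (N M : ℝ))
          (fun M => C₁ * (SparseRecovery.sparsity β M : ℝ)) →
      ∀ (D : ∀ M, SparseRecovery.Decoder (N M) M),
        (∀ M, D M = SparseRecovery.typicalityDecoder (N M) M ν
          (SparseRecovery.threshold ζ (SparseRecovery.minAbs (x M)) (N M)
            (SparseRecovery.sparsity β M))
          (SparseRecovery.sparsity β M)) →
        SparseRecovery.AsymptoticallyReliable D ν x ∧
        Tendsto (fun M : ℕ => -ENNReal.log (SparseRecovery.errorProb (D M) ν (x M)) /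
            ((Real.log (SparseRecovery.sparsity β M) : ℝ) : EReal))
          atTop (𝓝 ⊤) := by
  -- The constant 2 gives `N - L ≥ L` eventually. It need not grow with `β`, because for large `k`
  -- the rate exceeds every constant.
  refine ⟨2, one_lt_two, fun ν hν ζ hζ hζ1 x hx hμ N hN D hD => ?_⟩
  obtain rfl : D = fun M => SparseRecovery.typicalityDecoder (N M) M ν
      (SparseRecovery.threshold ζ (SparseRecovery.minAbs (x M)) (N M)
        (SparseRecovery.sparsity β M)) (SparseRecovery.sparsity β M) := funext hD
  have hβ0 : 0 < β := by linarith
  have hlog : Tendsto (fun M => Real.log (SparseRecovery.sparsity β M)) atTop atTop :=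
    Real.tendsto_log_atTop.comp
      (tendsto_natCast_atTop_atTop.comp (SparseRecovery.tendsto_sparsity hβ0))
  have key := fun (B : ℝ) (hB : 0 ≤ B) => SparseRecovery.eventually_errorProb_le hβ0 hν hζ hζ1 hx hμ
    (SparseRecovery.eventually_lt_of_dominates hβ0 hN) hB
  refine ⟨?_, ?_⟩
  · have h0 : Tendsto (fun M => ENNReal.ofReal (Real.exp
        (-(1 * Real.log (SparseRecovery.sparsity β M))))) atTop (𝓝 0) := by
      rw [← ENNReal.ofReal_zero]
      refine ENNReal.tendsto_ofReal (Real.tendsto_exp_neg_atTop_nhds_zero.comp ?_)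
      simpa only [one_mul] using hlog
    exact tendsto_of_tendsto_of_tendsto_of_le_of_le' tendsto_const_nhds h0
      (Eventually.of_forall fun _ => zero_le) (key 1 zero_le_one)
  · rw [EReal.tendsto_nhds_top_iff_real]
    intro B
    filter_upwards [key (|B| + 1) (by positivity), hlog.eventually (eventually_gt_atTop 0)]
      with M hM hlogM
    refine lt_of_lt_of_le ?_ (SparseRecovery.le_neg_log_div hlogM hM)
    exact_mod_cast (le_abs_self B).trans_lt (lt_add_one _)
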